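/- **Setting.** Let $d\ge 0$ and, for $1\le k\le 2d$, put $k^*:=2d+1-k$. Let $I(d,2d)$ be the set of $d$-element subsets of $\{1,\dots,2d\}$, ordered by $u\le w$ iff $u_1\le w_1,\dots,u_d\le w_d$ (elements listed increasingly). Let $I(d)\subseteq I(d,2d)$ be the set of those subsets that contain exactly one of $k,k^*$ for each $k$ and have evenly many elements exceeding $d$. Fix $v\in I(d)$. Let $\mathfrak R=\{(r,c): 1\le r,c\le 2d,\ r\notin v,\ c\in v\}$, $\mathfrak N=\{(r,c)\in\mathfrak R: r>c\}$, $\mathfrak{ON}=\{(r,c)\in\mathfrak N: r<c^*\}$, and let the diagonal be $\{(r,c)\in\mathfrak R: r=c^*\}$. Put $(r,c)^\#=(c^*,r^*)$, $p_v(r,c)=(c^*,c)$, $p_h(r,c)=(r,r^*)$. A monomial is a finite multiset; unions of monomials add multiplicities. Write $(R,C)>(r,c)$ if $R>r$ and $C<c$. A $v$-chain is a finite sequence $\alpha_1>\alpha_2>\cdots$, with head $\alpha_1$. The depth of $\alpha$ in a monomial is the maximal length of a $v$-chain in it that ends in $\alpha$. A subset $\mathfrak S\subseteq\mathfrak N$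 is distinguished if for all distinct $(R,C),(r,c)\in\mathfrak S$: $R\ne r$, $C\neq c$, and $R>r$ implies $r<C$ or $C<c$. To a set $\mathfrak S\subseteq \mathfrak N$ attach the set obtained from $v$ by removing the column indices $c$ and adding the row indices $r$ of all $(r,c)\in\mathfrak S$; this gives a bijection $\mathfrak S_w\leftrightarrow w$ between distinguished subsets of $\mathfrak N$ and elements $w\ge v$ of $I(d,2d)$. For $w\geq v$ let $w^k$ (resp. $w_{k,k+1}$) be the element attached to the set of elements of $\mathfrak S_w$ of depth $\ge k$ (resp. of depth $k$ or $k+1$) in $\mathfrak S_w$. An element $w$ dominates a $v$-chain in $\mathfrak N$ if $w\geq$ the element attached to the chain. *The map $\pi$.* Let $\mathfrak S$ be a monomial in $\mathfrak N$. For each $k$ arrange its elements of depth $k$ in non-decreasing order of both row and column indices; consecutive elements $(r,c),(r',c')$ are put in the same block iff $c'<r$. A block $\mathfrak B=\{(r_1,c_1),\dots,(r_p,c_p)\}$ yields $w(\mathfrak B)=(r_p,c_1)$ and $\mathfrak B'=\{(r_1,c_2),\dots,(r_{p-1},c_p)\}$. Then $\pi(\mathfrak S)=(w,\mathfrak S')$,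 where $w$ is attached to the set of all $w(\mathfrak B)$ and $\mathfrak S'$ is the union of all $\mathfrak B'$. *The map $\phi$.* Let $w\ge v$ in $I(d,2d)$ and $\mathfrak T$ a monomial in $\mathfrak N$ all of whose $v$-chains are dominated by $w$. For $\beta=(R,C)\in\mathfrak S_w$ of depth $k$, let its piece consist of those $(r,c)\in\mathfrak T$ with $r\le R$, $C\le c$, such that every $v$-chain in $\mathfrak T$ with head $(r,c)$ is dominated by $w^k$ and not every one is dominated by $w^{k+1}$. If $(r_1,c_1),\dots,(r_p,c_p)$ are its elements in non-decreasing order of row and column indices, replace the piece by $\{(r_1,C),(r_2,c_1),\dots,(r_p,c_{p-1}),(R,c_p)\}$ (which is $\{\beta\}$ if $p=0$). Then $\phi(w,\mathfrak T)$ is the union of these over $\beta\in\mathfrak S_w$. *$\mathfrak O$-domination and $\mathfrak O$-depth.* Let $C$ be a $v$-chain in $\mathfrak{ON}$. Consecutive elements $(r_1,c_1)>(r_2,c_2)$ are connected if $r_1^*\ge c_2$ and $r_2>r_1^*$; this partitions $C$ into connected components (maximal runs of consecutively connected elements). The last element $\lambda$ of a component of odd cardinality has type H if $p_h(\lambda)\in\mathfrak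 N$ and type S otherwise; all other elements have type V. Let $\mathfrak S_C\subseteq\mathfrak N$ be the union of the sets $\{p_v(\alpha)\}$, $\{p_v(\alpha),p_h(\alpha)\}$, $\{\alpha,\alpha^\#\}$ over the elements $\alpha$ of $C$ of type V, H, S respectively, and $w(C)$ the element attached to $\mathfrak S_C$. An element $w$ $\mathfrak O$-dominates $C$ if $w\ge w(C)$, and $\mathfrak O$-dominates a monomial in $\mathfrak{ON}$ if it $\mathfrak O$-dominates every $v$-chain in it. The $\mathfrak O$-depth of $\alpha$ in $C$ is the depth in $\mathfrak S_C$ of $\alpha$ if $\alpha$ has type S, and of $p_v(\alpha)$ otherwise; the $\mathfrak O$-depth of $\alpha$ in a monomial is the maximum of its $\mathfrak O$-depths in the $v$-chains in the monomial that contain $\alpha$. *The map $\pi_{\mathfrak O}$.* Let $\mathfrak S$ be a monomial in $\mathfrak{ON}$. For $j$ odd let $\mathfrak S^{\rm pr}_{j,j+1}$ be the submonomial of elements of $\mathfrak O$-depth $j$ or $j+1$, and $\sigma_j$ the last element, in non-decreasing order of row and column indices, among those of $\mathfrak O$-depth $j$. If $\sigma_j$ exists and $p_h(\sigma_j)\in\mathfrak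 N$, put $\mathfrak S_{j,j+1}=(\mathfrak S^{\rm pr}_{j,j+1}\setminus\{\sigma_j\})\cup(\mathfrak S^{\rm pr}_{j,j+1}\setminus\{\sigma_j\})^\#\cup\{p_v(\sigma_j),p_h(\sigma_j)\}$ (one copy of $\sigma_j$ being removed); otherwise $\mathfrak S_{j,j+1}=\mathfrak S^{\rm pr}_{j,j+1}\cup(\mathfrak S^{\rm pr}_{j,j+1})^\#$. Let $\mathfrak S_j,\mathfrak S_{j+1}$ be the submonomials of elements of depth $1$, $2$ in $\mathfrak S_{j,j+1}$, and $(w(k),\mathfrak S_k')=\pi(\mathfrak S_k)$ for all $k\geq 1$. Then $\pi_{\mathfrak O}(\mathfrak S)=(w,\mathfrak S')$, where $w$ is attached to $\bigcup_k\mathfrak S_{w(k)}$ and $\mathfrak S'$ is the part of $\bigcup_k\mathfrak S_k'$ in $\mathfrak{ON}$. (For $\mathfrak S$ empty this gives $(v,\emptyset)$.) *The map $\phi_{\mathfrak O}$.* Let $w\in I(d)$, $w\ge v$, and let $\mathfrak T$ be a monomial in $\mathfrak{ON}$ that is $\mathfrak O$-dominated by $w$. For $j$ odd let $\mathfrak T_{w,j,j+1}$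 be the submonomial of those $\alpha\in\mathfrak T$ such that every $v$-chain in $\mathfrak T$ with head $\alpha$ is $\mathfrak O$-dominated by $w^j$ and not every one is $\mathfrak O$-dominated by $w^{j+2}$. Let $\mathfrak P_j=\phi(w_{j,j+1},\mathfrak T_{w,j,j+1}\cup\mathfrak T_{w,j,j+1}^\#)$. It has either no diagonal elements or exactly two, $(a,a^*)$ and $(b,b^*)$ with $a>b$; in the latter case replace these two in $\mathfrak P_j$ by $(b,a^*)$ and $(a,b^*)$. Then $\phi_{\mathfrak O}(w,\mathfrak T)$ is the union, over all odd $j$, of the parts in $\mathfrak{ON}$ of the resulting monomials. **Proposition 4.3.** Fix $f$ with $1\le f\le 2d$. Say that a subset $w$ of $\{1,\dots,2d\}$ satisfies (‡) if $f\notin w$, and that a monomial satisfies (‡) if $f$ is not the row index and $f^*$ is not the column index of any of its elements. Assume that $v$ satisfies (‡). 1. Let $w\in I(d)$ with $w\ge v$ and let $\mathfrak T$ be a monomial in $\mathfrak{ON}$ that is $\mathfrak O$-dominated by $w$. If $w$ and $\mathfrak T$ both satisfy (‡), then so does $\phi_{\mathfrak O}(w,\mathfrak T)$. 2. If a monomial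 $\mathfrak S$ in $\mathfrak{ON}$ satisfies (‡), then so do both components $w$ and $\mathfrak S'$ of $\pi_{\mathfrak O}(\mathfrak S)=(w,\mathfrak S')$. -/

import Mathlib

namespace OrthoGrass

/-! ## Index sets -/

/-- The order reversing involution `k ↦ k^* = 2d + 1 - k` of `{1, …, 2d}`. -/
def star (d k : ℕ) : ℕ := 2 * d + 1 - k

/-- The set `I(d)`: the `d`-element subsets of `{1, …, 2d}` containing exactly one of `k`, `k^*`
for each `k`, and having evenly many entries exceeding `d`. -/
def I (d : ℕ) : Set (Finset ℕ) :=
  {u | u ⊆ Finset.Icc 1 (2 * d) ∧ u.card = d ∧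
    (∀ k ∈ Finset.Icc 1 (2 * d), Xor (k ∈ u) (star d k ∈ u)) ∧
    Even (u.filter (fun k => d < k)).card}

/-- The order on `d`-element subsets: `u ≤ w` iff `u₁ ≤ w₁, …, u_d ≤ w_d`, where
`u₁ < … < u_d` and `w₁ < … < w_d` are the elements of `u` and of `w`. -/
def Le (u w : Finset ℕ) : Prop := List.Forall₂ (· ≤ ·) u.sort w.sort

/-! ## Pairs `(r, c)` of a row index and a column index -/

/-- All pairs `(r, c)` with `r` not an entry and `c` an entry of `v`. -/
def roots (d : ℕ) (v : Finset ℕ) : Finset (ℕ × ℕ) :=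
  (Finset.Icc 1 (2 * d) ×ˢ Finset.Icc 1 (2 * d)).filter (fun a => a.1 ∉ v ∧ a.2 ∈ v)

/-- The pairs `(r, c)` with `r > c`. -/
def pos (d : ℕ) (v : Finset ℕ) : Finset (ℕ × ℕ) := (roots d v).filter (fun a => a.2 < a.1)

/-- The pairs `(r, c)` with `r > c` and `r < c^*`, that is, the elements of `pos d v` which are
strictly above the diagonal. -/
def orthoPos (d : ℕ) (v : Finset ℕ) : Finset (ℕ × ℕ) :=
  (roots d v).filter (fun a => a.2 < a.1 ∧ a.1 < star d a.2)

/-- The diagonal: the pairs `(r, c)` with `r = c^*`. -/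
def diag (d : ℕ) (v : Finset ℕ) : Finset (ℕ × ℕ) :=
  (roots d v).filter (fun a => a.1 = star d a.2)

/-- `S` is a monomial (that is, a multiset) in the set `A`. -/
def IsMonomialIn (A : Finset (ℕ × ℕ)) (S : Multiset (ℕ × ℕ)) : Prop := ∀ a ∈ S, a ∈ A

/-- Reflection in the diagonal: `(r, c)^# = (c^*, r^*)`. -/
def hash (d : ℕ) (a : ℕ × ℕ) : ℕ × ℕ := (star d a.2, star d a.1)

/-- The vertical projection `p_v(r, c) = (c^*, c)`. -/
def pv (d : ℕ) (a : ℕ × ℕ) : ℕ × ℕ := (star d a.2, a.2)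

/-- The horizontal projection `p_h(r, c) = (r, r^*)`. -/
def ph (d : ℕ) (a : ℕ × ℕ) : ℕ × ℕ := (a.1, star d a.1)

/-- The strict relation `(R, C) > (r, c)`, meaning `R > r` and `C < c`. -/
def Gt (a b : ℕ × ℕ) : Prop := b.1 < a.1 ∧ a.2 < b.2

/-- `C : α₁ > α₂ > …` is a `v`-chain in the monomial `S` (itself in `pos d v`). -/
def IsVChainIn (S : Multiset (ℕ × ℕ)) (C : List (ℕ × ℕ)) : Prop :=
  (∀ a ∈ C, a ∈ S) ∧ C.IsChain Gt

/-- The depth of `a` in the monomial `S`: the maximal length of a `v`-chain in `S` with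
tail `a`. -/
noncomputable def depth (S : Multiset (ℕ × ℕ)) (a : ℕ × ℕ) : ℕ :=
  sSup {n | ∃ C : List (ℕ × ℕ), IsVChainIn S C ∧ C.getLast? = some a ∧ C.length = n}

/-- The elements (with multiplicities) of depth `k` in `S`. -/
noncomputable def ofDepth (S : Multiset (ℕ × ℕ)) (k : ℕ) : Multiset (ℕ × ℕ) :=
  S.filter (fun a => depth S a = k)

/-- The elements of `S` listed in lexicographic order. If no two elements of `S` are comparable
for `Gt`, this is the arrangement of `S` in non-decreasing order of both row indices and column
indices. -/
def arrange (S : Multiset (ℕ × ℕ)) : List (ℕ × ℕ) := ((S.map toLex).sort).map ofLex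

/-! ## Distinguished subsets -/

/-- Distinguished subsets of `pos d v`. -/
def IsDistinguished (d : ℕ) (v : Finset ℕ) (S : Finset (ℕ × ℕ)) : Prop :=
  S ⊆ pos d v ∧ ∀ a ∈ S, ∀ b ∈ S, a ≠ b →
    (a.1 ≠ b.1 ∧ a.2 ≠ b.2) ∧ (b.1 < a.1 → b.1 < a.2 ∨ a.2 < b.2)

/-- The element attached to a (distinguished) set `S` of pairs: remove from `v` the column indices
of the elements of `S`, and add their row indices. -/
def assoc (v : Finset ℕ) (S : Finset (ℕ × ℕ)) : Finset ℕ :=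
  (v \ S.image Prod.snd) ∪ S.image Prod.fst

open Classical in
/-- The distinguished subset `𝔖_w` of `pos d v` corresponding to a `d`-element set `w ≥ v`: the
unique distinguished subset to which `w` is attached. -/
noncomputable def distMon (d : ℕ) (v w : Finset ℕ) : Finset (ℕ × ℕ) :=
  if h : ∃ S, IsDistinguished d v S ∧ assoc v S = w then h.choose else ∅

/-! ## The maps `π` and `φ` for the ordinary Grassmannian -/

/-- The blocks of a monomial without comparable elements: in the arrangement of its elements,
consecutive elements `(r₁, c₁)`, `(r₂, c₂)` are in the same block iff `c₂ < r₁`. -/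
def blocks (S : Multiset (ℕ × ℕ)) : List (List (ℕ × ℕ)) :=
  (arrange S).splitBy (fun a b => decide (b.2 < a.1))

/-- For a block `(r₁, c₁), …, (r_p, c_p)`, the element `w(𝔅) = (r_p, c₁)` (as a singleton; empty
for the empty list, which is never a block). -/
def blockW (B : List (ℕ × ℕ)) : Finset (ℕ × ℕ) :=
  match B.getLast?, B.head? with
  | some l, some h => {(l.1, h.2)}
  | _, _ => ∅

/-- For a block `(r₁, c₁), …, (r_p, c_p)`, the monomial `𝔅' = {(r₁, c₂), …, (r_{p-1}, c_p)}`. -/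
def blockPrime (B : List (ℕ × ℕ)) : Multiset (ℕ × ℕ) :=
  (List.zipWith (fun a b => (a.1, b.2)) B B.tail : List (ℕ × ℕ))

/-- The map `π`, from monomials `S` in `pos d v` to pairs `(w, S')`. The depths occurring in `S`
are at most `d`, so it suffices to let `k` run up to `2 * d`. -/
noncomputable def piMap (d : ℕ) (v : Finset ℕ) (S : Multiset (ℕ × ℕ)) :
    Finset ℕ × Multiset (ℕ × ℕ) :=
  (assoc v ((Finset.Icc 1 (2 * d)).biUnion fun k =>
      (blocks (ofDepth S k)).toFinset.biUnion blockW),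
    ∑ k ∈ Finset.Icc 1 (2 * d), ((blocks (ofDepth S k)).map blockPrime).sum)

/-- The elements of `𝔖_w` of depth at least `k` in `𝔖_w`. -/
noncomputable def distMonGE (d : ℕ) (v w : Finset ℕ) (k : ℕ) : Finset (ℕ × ℕ) :=
  (distMon d v w).filter (fun b => k ≤ depth (distMon d v w).val b)

/-- The element `w^k` attached to the elements of `𝔖_w` of depth at least `k`. -/
noncomputable def upper (d : ℕ) (v w : Finset ℕ) (k : ℕ) : Finset ℕ :=
  assoc v (distMonGE d v w k)

/-- `w` dominates the `v`-chain `C` of elements of `pos d v` (in the sense of the ordinary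
Grassmannian). -/
def DominatesChain (v w : Finset ℕ) (C : List (ℕ × ℕ)) : Prop := Le (assoc v C.toFinset) w

open Classical in
/-- The part `T_k` of `T` with respect to `w`: the elements `a` such that every `v`-chain in `T`
with head `a` is dominated by `w^k`, but not every such chain is dominated by `w^{k+1}`. -/
noncomputable def part (d : ℕ) (v w : Finset ℕ) (T : Multiset (ℕ × ℕ)) (k : ℕ) :
    Multiset (ℕ × ℕ) :=
  T.filter (fun a =>
    (∀ C, IsVChainIn T C → C.head? = some a → DominatesChain v (upper d v w k) C) ∧
    ∃ C, IsVChainIn T C ∧ C.head? = some a ∧ ¬ DominatesChain v (upper d v w (k + 1)) C)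

/-- The piece `𝔓_β` of `T`, for `β = (R, C)` in `𝔖_w` of depth `k`: the elements `(r, c)` of `T_k`
dominated by `β`, i.e. with `r ≤ R` and `C ≤ c`. -/
noncomputable def piece (d : ℕ) (v w : Finset ℕ) (T : Multiset (ℕ × ℕ)) (b : ℕ × ℕ) :
    Multiset (ℕ × ℕ) :=
  (part d v w T (depth (distMon d v w).val b)).filter (fun a => a.1 ≤ b.1 ∧ b.2 ≤ a.2)

/-- For a piece `P = {(r₁, c₁), …, (r_p, c_p)}` (arranged in non-decreasing order of row and column
indices) corresponding to `β = (R, C)`, the monomial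
`P^* = {(r₁, C), (r₂, c₁), …, (r_p, c_{p-1}), (R, c_p)}`; it is `{β}` if `P` is empty. -/
def pieceStar (b : ℕ × ℕ) (P : Multiset (ℕ × ℕ)) : Multiset (ℕ × ℕ) :=
  (((arrange P).map Prod.fst ++ [b.1]).zip (b.2 :: (arrange P).map Prod.snd) : List (ℕ × ℕ))

/-- The map `φ`, from pairs `(w, T)`, where `w ≥ v` dominates the monomial `T` in `pos d v`, to
monomials in `pos d v`. -/
noncomputable def phiMap (d : ℕ) (v w : Finset ℕ) (T : Multiset (ℕ × ℕ)) : Multiset (ℕ × ℕ) :=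
  ∑ b ∈ distMon d v w, pieceStar b (piece d v w T b)

/-! ## `v`-chains in `orthoPos d v` -/

/-- Consecutive elements `a = (r₁, c₁) > b = (r₂, c₂)` of a `v`-chain are connected if
`r₁^* ≥ c₂` and `(r₂, r₁^*)` belongs to `pos d v`. -/
def Connected (d : ℕ) (v : Finset ℕ) (a b : ℕ × ℕ) : Prop :=
  b.2 ≤ star d a.1 ∧ (b.1, star d a.1) ∈ pos d v

instance (d : ℕ) (v : Finset ℕ) (a b : ℕ × ℕ) : Decidable (Connected d v a b) :=
  inferInstanceAs (Decidable (_ ∧ _))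

/-- The connected components of a `v`-chain. -/
def components (d : ℕ) (v : Finset ℕ) (C : List (ℕ × ℕ)) : List (List (ℕ × ℕ)) :=
  C.splitBy (fun a b => decide (Connected d v a b))

/-- The set `𝔖_K` attached to a connected `v`-chain `K : α₁ > … > α_ℓ`. -/
def monConn (d : ℕ) (v : Finset ℕ) (K : List (ℕ × ℕ)) : Finset (ℕ × ℕ) :=
  match K.getLast? with
  | none => ∅
  | some l =>
    if Even K.length then (K.map (pv d)).toFinset
    else if ph d l ∈ pos d v then (K.map (pv d)).toFinset ∪ {ph d l}
    else (K.dropLast.map (pv d)).toFinset ∪ {l, hash d l}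

/-- The set `𝔖_C` attached to a `v`-chain `C`. -/
def monChain (d : ℕ) (v : Finset ℕ) (C : List (ℕ × ℕ)) : Finset (ℕ × ℕ) :=
  (components d v C).toFinset.biUnion (monConn d v)

/-- The element `w(C)` attached to a `v`-chain `C`. -/
def wChain (d : ℕ) (v : Finset ℕ) (C : List (ℕ × ℕ)) : Finset ℕ := assoc v (monChain d v C)

/-- `w` `𝔒`-dominates the `v`-chain `C`. -/
def ODominatesChain (d : ℕ) (v w : Finset ℕ) (C : List (ℕ × ℕ)) : Prop := Le (wChain d v C) w

/-- `w` `𝔒`-dominates the monomial `S` in `orthoPos d v`. -/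
def ODominates (d : ℕ) (v w : Finset ℕ) (S : Multiset (ℕ × ℕ)) : Prop :=
  ∀ C, IsVChainIn S C → ODominatesChain d v w C

/-- The element `a` of the `v`-chain `C` is of type `S`: it is the last element of its connected
component, this component has odd cardinality, and `p_h(a)` is not in `pos d v`. -/
def IsTypeS (d : ℕ) (v : Finset ℕ) (C : List (ℕ × ℕ)) (a : ℕ × ℕ) : Prop :=
  ∃ K ∈ components d v C, K.getLast? = some a ∧ Odd K.length ∧ ph d a ∉ pos d v

open Classical in
/-- The element `q_{C,a}` of `𝔖_C`: it is `a` if `a` is of type `S` in `C`, and `p_v(a)` otherwise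
(types `V` and `H`). -/
noncomputable def qChain (d : ℕ) (v : Finset ℕ) (C : List (ℕ × ℕ)) (a : ℕ × ℕ) : ℕ × ℕ :=
  if IsTypeS d v C a then a else pv d a

/-- The `𝔒`-depth of an element `a` of the `v`-chain `C`: the depth of `q_{C,a}` in `𝔖_C`. -/
noncomputable def oDepthChain (d : ℕ) (v : Finset ℕ) (C : List (ℕ × ℕ)) (a : ℕ × ℕ) : ℕ :=
  depth (monChain d v C).val (qChain d v C a)

/-- The `𝔒`-depth of an element `a` of the monomial `S` in `orthoPos d v`: the maximum, over all
`v`-chains `C` in `S` containing `a`, of the `𝔒`-depth of `a` in `C`. -/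
noncomputable def oDepth (d : ℕ) (v : Finset ℕ) (S : Multiset (ℕ × ℕ)) (a : ℕ × ℕ) : ℕ :=
  sSup {n | ∃ C : List (ℕ × ℕ), IsVChainIn S C ∧ a ∈ C ∧ oDepthChain d v C a = n}

/-! ## The map `π_𝔒` -/

/-- The elements of `S` of `𝔒`-depth `k`. -/
noncomputable def monPr (d : ℕ) (v : Finset ℕ) (S : Multiset (ℕ × ℕ)) (k : ℕ) :
    Multiset (ℕ × ℕ) :=
  S.filter (fun a => oDepth d v S a = k)

/-- The element `σ_k`, the last one in the arrangement of the elements of `𝔒`-depth `k`. -/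
noncomputable def sigma? (d : ℕ) (v : Finset ℕ) (S : Multiset (ℕ × ℕ)) (k : ℕ) :
    Option (ℕ × ℕ) :=
  (arrange (monPr d v S k)).getLast?

/-- For `j` odd, the symmetric monomial `𝔖_{j,j+1}` in `pos d v` (the first alternative is the case
where `S` is truly orthogonal at `j`). -/
noncomputable def monPair (d : ℕ) (v : Finset ℕ) (S : Multiset (ℕ × ℕ)) (j : ℕ) :
    Multiset (ℕ × ℕ) :=
  let M := monPr d v S j + monPr d v S (j + 1)
  match sigma? d v S j with
  | some s =>
    if ph d s ∈ pos d v then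
      M.erase s + (M.erase s).map (hash d) + {pv d s, ph d s}
    else M + M.map (hash d)
  | none => M + M.map (hash d)

/-- The odd integers which may occur as `𝔒`-depths or as depths (these are all at most `d`). -/
def odds (d : ℕ) : Finset ℕ := (Finset.Icc 1 (2 * d)).filter Odd

/-- The monomial `𝔖_k`, for `k ∈ {j, j + 1}`: the elements of depth `k - j + 1` in `𝔖_{j,j+1}`;
here `k = j + i` with `i ∈ {0, 1}`. -/
noncomputable def monOf (d : ℕ) (v : Finset ℕ) (S : Multiset (ℕ × ℕ)) (j i : ℕ) :
    Multiset (ℕ × ℕ) :=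
  ofDepth (monPair d v S j) (i + 1)

/-- The map `π_𝔒`, from monomials `S` in `orthoPos d v` to pairs `(w, S')`. With
`π(𝔖_k) = (w(k), 𝔖_k')`, the element `w` is attached to the union of the `𝔖_{w(k)}`, and `S'` is
the part of the union of the `𝔖_k'` that is strictly above the diagonal. -/
noncomputable def piO (d : ℕ) (v : Finset ℕ) (S : Multiset (ℕ × ℕ)) :
    Finset ℕ × Multiset (ℕ × ℕ) :=
  (assoc v ((odds d).biUnion fun j => (Finset.range 2).biUnion fun i =>
      distMon d v (piMap d v (monOf d v S j i)).1),
    (∑ j ∈ odds d, ∑ i ∈ Finset.range 2, (piMap d v (monOf d v S j i)).2).filter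
      (fun a => a ∈ orthoPos d v))

/-! ## The map `φ_𝔒` -/

/-- The element `w_{j,j+1}` attached to the elements of `𝔖_w` of depth `j` or `j + 1`. -/
noncomputable def wPair (d : ℕ) (v w : Finset ℕ) (j : ℕ) : Finset ℕ :=
  assoc v ((distMon d v w).filter fun b =>
    depth (distMon d v w).val b = j ∨ depth (distMon d v w).val b = j + 1)

open Classical in
/-- The part `T_{w,j,j+1}` of `T`: the elements `a` such that every `v`-chain in `T` with head `a`
is `𝔒`-dominated by `w^j`, but not every such chain is `𝔒`-dominated by `w^{j+2}`. -/
noncomputable def partO (d : ℕ) (v w : Finset ℕ) (T : Multiset (ℕ × ℕ)) (j : ℕ) :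
    Multiset (ℕ × ℕ) :=
  T.filter (fun a =>
    (∀ C, IsVChainIn T C → C.head? = some a → ODominatesChain d v (upper d v w j) C) ∧
    ∃ C, IsVChainIn T C ∧ C.head? = some a ∧ ¬ ODominatesChain d v (upper d v w (j + 2)) C)

/-- The monomial `(T_{w,j,j+1} ∪ T_{w,j,j+1}^#)^*` in `pos d v`. -/
noncomputable def partStar (d : ℕ) (v w : Finset ℕ) (T : Multiset (ℕ × ℕ)) (j : ℕ) :
    Multiset (ℕ × ℕ) :=
  phiMap d v (wPair d v w j) (partO d v w T j + (partO d v w T j).map (hash d))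

/-- Twisting: if the monomial `P` contains a pair `(a, a^*)`, `(b, b^*)` of diagonal elements, with
`a > b`, these are replaced by `δ = (b, a^*)` and `δ^#`; otherwise `P` is unchanged. (The monomials
to which this is applied have either none or exactly two diagonal elements.) -/
def twist (d : ℕ) (v : Finset ℕ) (P : Multiset (ℕ × ℕ)) : Multiset (ℕ × ℕ) :=
  match arrange (P.filter (fun x => x ∈ diag d v)) with
  | [y, x] => P.filter (fun x => x ∉ diag d v) + {(y.1, x.2), hash d (y.1, x.2)}
  | _ => P

/-- The map `φ_𝔒`, from pairs `(w, T)`, where `w ≥ v` is an element of `I d` that `𝔒`-dominates the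
monomial `T` in `orthoPos d v`, to monomials in `orthoPos d v`. -/
noncomputable def phiO (d : ℕ) (v w : Finset ℕ) (T : Multiset (ℕ × ℕ)) : Multiset (ℕ × ℕ) :=
  ∑ j ∈ odds d, (twist d v (partStar d v w T j)).filter (fun a => a ∈ orthoPos d v)

/-! ## The condition (‡) -/

/-- (‡) for a set `w` of indices: `f` is not an entry of `w`. -/
def DdagSet (f : ℕ) (w : Finset ℕ) : Prop := f ∉ w

/-- (‡) for a monomial `S`: `f` is not the row index, and `f^*` is not the column index, of any
element of `S`. -/
def DdagMon (d f : ℕ) (S : Multiset (ℕ × ℕ)) : Prop :=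
  (∀ a ∈ S, a.1 ≠ f) ∧ ∀ a ∈ S, a.2 ≠ star d f

end OrthoGrass

/-!
The condition (‡) concerns only which numbers occur as row and as column indices, and every step
of `π_𝔒` and `φ_𝔒` merely recombines such indices.

* The reflection `#`, the projections `p_v`, `p_h` and the twist may also replace an index `k` by
  `k^*`, but they then exchange rows and columns. Since (‡) forbids the row `f` together with the
  column `f^*`, it is preserved (`DdagMon.hash`, `DdagMon.projections`, `DdagMon.twist`).
* Passing to blocks and pieces only shuffles indices; the new monomials `𝔅'` and `𝔓^*` take their
  indices from the old ones and, in the case of `𝔓^*`, from `β ∈ 𝔖_w` (`DdagMon.piMap_snd`,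
  `DdagMon.pieceStar`).
* If `w` is attached to a set `𝔖` of pairs in `pos d v`, then the rows of `𝔖` lie in `w`, and its
  columns, which lie in `v`, do not. Hence `𝔖_w` satisfies (‡) as soon as `f ∉ w` and `f^* ∈ w`
  (`ddagMon_distMon`). Conversely, if `𝔖` satisfies (‡) and `f ∉ v`, `f^* ∈ v`, then the attached
  element avoids `f` and contains `f^*`. For elements of `I d` the conditions `f ∉ w` and
  `f^* ∈ w` are equivalent; `w_{j,j+1}` inherits both from `w`, being attached to a subset of `𝔖_w`.
-/

namespace OrthoGrass

variable {d f : ℕ} {v w : Finset ℕ} {S T : Multiset (ℕ × ℕ)}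

/-! ### The condition (‡) and the elementary operations -/

theorem eq_star_of_star_eq (hf : 1 ≤ f) {k : ℕ} (h : star d k = f) : k = star d f := by
  unfold star at *
  omega

-- Truncated subtraction does no harm: `star d f` is positive because `f ≤ 2 * d`.
theorem eq_of_star_eq_star (hf : f ≤ 2 * d) {k : ℕ} (h : star d k = star d f) : k = f := by
  unfold star at *
  omega

theorem star_mem_of_notMem (hf : 1 ≤ f ∧ f ≤ 2 * d) (hw : w ∈ I d) (h : f ∉ w) :
    star d f ∈ w := by
  have := hw.2.2.1 f (Finset.mem_Icc.2 hf)
  unfold Xor at this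
  tauto

theorem DdagMon.mono (h : DdagMon d f S) (hT : ∀ a ∈ T, a ∈ S) : DdagMon d f T :=
  ⟨fun a ha => h.1 a (hT a ha), fun a ha => h.2 a (hT a ha)⟩

theorem DdagMon.add (hS : DdagMon d f S) (hT : DdagMon d f T) : DdagMon d f (S + T) := by
  constructor <;> intro a ha <;> rcases Multiset.mem_add.1 ha with h | h
  exacts [hS.1 a h, hT.1 a h, hS.2 a h, hT.2 a h]

theorem ddagMon_sum {ι : Type*} {s : Finset ι} {F : ι → Multiset (ℕ × ℕ)}
    (h : ∀ i ∈ s, DdagMon d f (F i)) : DdagMon d f (∑ i ∈ s, F i) := by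
  constructor <;> intro a ha <;> obtain ⟨i, hi, hai⟩ := Multiset.mem_sum.1 ha
  exacts [(h i hi).1 a hai, (h i hi).2 a hai]

theorem ddagMon_pair {a b : ℕ × ℕ} (ha : a.1 ≠ f ∧ a.2 ≠ star d f)
    (hb : b.1 ≠ f ∧ b.2 ≠ star d f) : DdagMon d f {a, b} := by
  constructor <;> intro x hx <;>
    rcases (by simpa using hx : x = a ∨ x = b) with rfl | rfl
  exacts [ha.1, hb.1, ha.2, hb.2]

theorem DdagMon.hash (hf : 1 ≤ f ∧ f ≤ 2 * d) (h : DdagMon d f S) :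
    DdagMon d f (S.map (hash d)) := by
  constructor <;> intro a ha <;> obtain ⟨b, hb, rfl⟩ := Multiset.mem_map.1 ha <;> intro he
  · exact h.2 b hb (eq_star_of_star_eq hf.1 he)
  · exact h.1 b hb (eq_of_star_eq_star hf.2 he)

theorem DdagMon.projections (hf : 1 ≤ f ∧ f ≤ 2 * d) (h : DdagMon d f S) {a : ℕ × ℕ}
    (ha : a ∈ S) : DdagMon d f {pv d a, ph d a} :=
  ddagMon_pair ⟨fun he => h.2 a ha (eq_star_of_star_eq hf.1 he), h.2 a ha⟩
    ⟨h.1 a ha, fun he => h.1 a ha (eq_of_star_eq_star hf.2 he)⟩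

theorem mem_arrange {a : ℕ × ℕ} : a ∈ arrange S ↔ a ∈ S := by
  simp only [arrange, List.mem_map, Multiset.mem_sort, Multiset.mem_map]
  exact ⟨fun ⟨_, ⟨b, hb, hx⟩, ha⟩ => by rwa [← ha, ← hx], fun ha => ⟨_, ⟨a, ha, rfl⟩, rfl⟩⟩

theorem DdagMon.twist (hf : 1 ≤ f ∧ f ≤ 2 * d) (h : DdagMon d f S) :
    DdagMon d f (twist d v S) := by
  unfold OrthoGrass.twist
  split
  · rename_i y x heq
    have hmem : ∀ z ∈ [y, x], z ∈ S := fun z hz =>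
      (Multiset.mem_filter.1 (mem_arrange.1 (heq ▸ hz))).1
    have hy := hmem y (by simp)
    have hx := hmem x (by simp)
    refine (h.mono fun a ha => (Multiset.mem_filter.1 ha).1).add
      (ddagMon_pair ⟨h.1 y hy, h.2 x hx⟩ ⟨fun he => ?_, fun he => ?_⟩)
    · exact h.2 x hx (eq_star_of_star_eq hf.1 he)
    · exact h.1 y hy (eq_of_star_eq_star hf.2 he)
  · exact h

/-! ### Attached elements and distinguished subsets -/

theorem notMem_assoc {A : Finset (ℕ × ℕ)} (hv : f ∉ v) (h : ∀ a ∈ A, a.1 ≠ f) :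
    f ∉ assoc v A := by
  simp only [assoc, Finset.mem_union, Finset.mem_sdiff, Finset.mem_image, not_or]
  exact ⟨fun h' => hv h'.1, fun ⟨a, ha, he⟩ => h a ha he⟩

theorem mem_assoc {A : Finset (ℕ × ℕ)} {k : ℕ} (hv : k ∈ v) (h : ∀ a ∈ A, a.2 ≠ k) :
    k ∈ assoc v A := by
  simp only [assoc, Finset.mem_union, Finset.mem_sdiff, Finset.mem_image]
  exact Or.inl ⟨hv, fun ⟨a, ha, he⟩ => h a ha he⟩

theorem row_mem_of_mem_distMon {a : ℕ × ℕ} (ha : a ∈ distMon d v w) : a.1 ∈ w := by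
  unfold distMon at ha
  split at ha
  · rename_i h
    rw [← h.choose_spec.2]
    exact Finset.mem_union_right _ (Finset.mem_image_of_mem _ ha)
  · simp at ha

/-- The columns of `𝔖_w` are removed from `v`, and no row can put them back, as rows avoid `v`. -/
theorem col_notMem_of_mem_distMon {a : ℕ × ℕ} (ha : a ∈ distMon d v w) : a.2 ∉ w := by
  unfold distMon at ha
  split at ha
  · rename_i h
    have hroot : ∀ b ∈ h.choose, b.1 ∉ v ∧ b.2 ∈ v := fun b hb =>
      (Finset.mem_filter.1 (Finset.mem_filter.1 (h.choose_spec.1.1 hb)).1).2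
    intro hw
    rw [← h.choose_spec.2, assoc, Finset.mem_union, Finset.mem_sdiff] at hw
    rcases hw with hw | hw
    · exact hw.2 (Finset.mem_image_of_mem _ ha)
    · obtain ⟨b, hb, he⟩ := Finset.mem_image.1 hw
      exact (hroot b hb).1 (he ▸ (hroot a ha).2)
  · simp at ha

theorem ddagMon_distMon (h : f ∉ w) (h' : star d f ∈ w) : DdagMon d f (distMon d v w).val :=
  ⟨fun _ ha he => h (he ▸ row_mem_of_mem_distMon ha),
    fun _ ha he => col_notMem_of_mem_distMon ha (he ▸ h')⟩

/-! ### The maps `φ` and `π` -/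

theorem DdagMon.pieceStar {b : ℕ × ℕ} (hb : b.1 ≠ f ∧ b.2 ≠ star d f) (h : DdagMon d f S) :
    DdagMon d f (pieceStar b S) := by
  constructor <;> rintro ⟨r, c⟩ ha <;> have ha := List.of_mem_zip (Multiset.mem_coe.1 ha)
  · rcases List.mem_append.1 ha.1 with hr | hr
    · obtain ⟨x, hx, rfl⟩ := List.mem_map.1 hr
      exact h.1 x (mem_arrange.1 hx)
    · exact List.mem_singleton.1 hr ▸ hb.1
  · rcases List.mem_cons.1 ha.2 with rfl | hc
    · exact hb.2
    · obtain ⟨x, hx, rfl⟩ := List.mem_map.1 hc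
      exact h.2 x (mem_arrange.1 hx)

theorem DdagMon.phiMap (hw : f ∉ w) (hw' : star d f ∈ w) (h : DdagMon d f T) :
    DdagMon d f (phiMap d v w T) := by
  have hdist := ddagMon_distMon (v := v) hw hw'
  refine ddagMon_sum fun b hb => DdagMon.pieceStar ⟨hdist.1 b hb, hdist.2 b hb⟩ (h.mono ?_)
  classical
  exact fun _ ha => Multiset.mem_of_mem_filter (Multiset.mem_of_mem_filter ha)

theorem mem_of_mem_blocks {B : List (ℕ × ℕ)} {a : ℕ × ℕ} (hB : B ∈ blocks S) (ha : a ∈ B) :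
    a ∈ S := by
  rw [← mem_arrange, ← List.flatten_splitBy (fun a b => decide (b.2 < a.1)) (arrange S)]
  exact List.mem_flatten.2 ⟨B, hB, ha⟩

theorem mem_of_mem_ofDepth {k : ℕ} {a : ℕ × ℕ} (ha : a ∈ ofDepth S k) : a ∈ S :=
  (Multiset.mem_filter.1 ha).1

theorem row_blockW {B : List (ℕ × ℕ)} {a : ℕ × ℕ} (ha : a ∈ blockW B) :
    ∃ b ∈ B, b.1 = a.1 := by
  unfold blockW at ha
  split at ha
  · rename_i l _ hl _
    rw [Finset.mem_singleton] at ha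
    exact ⟨l, List.mem_of_getLast? hl, by rw [ha]⟩
  · simp at ha

theorem notMem_piMap_fst (hv : f ∉ v) (h : ∀ a ∈ S, a.1 ≠ f) : f ∉ (piMap d v S).1 := by
  refine notMem_assoc hv fun a ha => ?_
  obtain ⟨k, _, ha⟩ := Finset.mem_biUnion.1 ha
  obtain ⟨B, hB, ha⟩ := Finset.mem_biUnion.1 ha
  obtain ⟨b, hb, he⟩ := row_blockW ha
  exact he ▸ h b (mem_of_mem_ofDepth (mem_of_mem_blocks (List.mem_toFinset.1 hB) hb))

theorem mem_blockPrime {B : List (ℕ × ℕ)} {a : ℕ × ℕ} (ha : a ∈ blockPrime B) :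
    (∃ b ∈ B, b.1 = a.1) ∧ ∃ b ∈ B, b.2 = a.2 := by
  rw [blockPrime, Multiset.mem_coe, ← List.map_uncurry_zip_eq_zipWith] at ha
  obtain ⟨⟨x, y⟩, hxy, rfl⟩ := List.mem_map.1 ha
  have hmem := List.of_mem_zip hxy
  exact ⟨⟨x, hmem.1, rfl⟩, ⟨y, List.mem_of_mem_tail hmem.2, rfl⟩⟩

theorem DdagMon.piMap_snd (h : DdagMon d f S) : DdagMon d f (piMap d v S).2 := by
  dsimp only [OrthoGrass.piMap]
  refine ddagMon_sum fun k _ => ?_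
  have key : ∀ a ∈ ((blocks (ofDepth S k)).map blockPrime).sum,
      (∃ b ∈ S, b.1 = a.1) ∧ ∃ b ∈ S, b.2 = a.2 := by
    intro a ha
    rw [← Multiset.sum_coe, ← Multiset.join, Multiset.mem_join] at ha
    obtain ⟨P, hP, haP⟩ := ha
    obtain ⟨B, hB, rfl⟩ := List.mem_map.1 (Multiset.mem_coe.1 hP)
    obtain ⟨⟨x, hx, hx'⟩, ⟨y, hy, hy'⟩⟩ := mem_blockPrime haP
    exact ⟨⟨x, mem_of_mem_ofDepth (mem_of_mem_blocks hB hx), hx'⟩,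
      ⟨y, mem_of_mem_ofDepth (mem_of_mem_blocks hB hy), hy'⟩⟩
  constructor <;> intro a ha
  · obtain ⟨b, hb, he⟩ := (key a ha).1
    exact he ▸ h.1 b hb
  · obtain ⟨b, hb, he⟩ := (key a ha).2
    exact he ▸ h.2 b hb

/-! ### The maps `φ_𝔒` and `π_𝔒` -/

theorem notMem_wPair (hv : f ∉ v) (hw : f ∉ w) (j : ℕ) : f ∉ wPair d v w j :=
  notMem_assoc hv fun _ ha he =>
    hw (he ▸ row_mem_of_mem_distMon (Finset.mem_filter.1 ha).1)

theorem mem_wPair {k : ℕ} (hv : k ∈ v) (hw : k ∈ w) (j : ℕ) : k ∈ wPair d v w j :=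
  mem_assoc hv fun _ ha he =>
    col_notMem_of_mem_distMon (Finset.mem_filter.1 ha).1 (he ▸ hw)

theorem DdagMon.partStar (hf : 1 ≤ f ∧ f ≤ 2 * d) (hv : v ∈ I d) (hvf : f ∉ v)
    (hw : w ∈ I d) (hwf : f ∉ w) (h : DdagMon d f T) (j : ℕ) :
    DdagMon d f (partStar d v w T j) := by
  classical
  have hpart : DdagMon d f (partO d v w T j) := h.mono fun _ ha => Multiset.mem_of_mem_filter ha
  exact DdagMon.phiMap (notMem_wPair hvf hwf j)
    (mem_wPair (star_mem_of_notMem hf hv hvf) (star_mem_of_notMem hf hw hwf) j)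
    (hpart.add (hpart.hash hf))

theorem DdagMon.phiO (hf : 1 ≤ f ∧ f ≤ 2 * d) (hv : v ∈ I d) (hvf : f ∉ v)
    (hw : w ∈ I d) (hwf : f ∉ w) (h : DdagMon d f T) : DdagMon d f (phiO d v w T) :=
  ddagMon_sum fun j _ => ((h.partStar hf hv hvf hw hwf j).twist hf).mono
    fun _ ha => (Multiset.mem_filter.1 ha).1

theorem DdagMon.monPair (hf : 1 ≤ f ∧ f ≤ 2 * d) (h : DdagMon d f S) (j : ℕ) :
    DdagMon d f (monPair d v S j) := by
  have hpr : ∀ k, ∀ a ∈ monPr d v S k, a ∈ S := fun k a ha => (Multiset.mem_filter.1 ha).1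
  have hM : DdagMon d f (monPr d v S j + monPr d v S (j + 1)) :=
    (h.mono (hpr j)).add (h.mono (hpr (j + 1)))
  unfold OrthoGrass.monPair
  split
  · rename_i s hs
    have hsS : s ∈ S := hpr j s (mem_arrange.1 (List.mem_of_getLast? hs))
    split
    · have hE := hM.mono fun a (ha : a ∈ Multiset.erase _ s) => Multiset.mem_of_mem_erase ha
      exact (hE.add (hE.hash hf)).add (h.projections hf hsS)
    · exact hM.add (hM.hash hf)
  · exact hM.add (hM.hash hf)

theorem DdagMon.monOf (hf : 1 ≤ f ∧ f ≤ 2 * d) (h : DdagMon d f S) (j i : ℕ) :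
    DdagMon d f (monOf d v S j i) :=
  (h.monPair hf j).mono fun _ => mem_of_mem_ofDepth

theorem notMem_piO_fst (hf : 1 ≤ f ∧ f ≤ 2 * d) (hvf : f ∉ v) (h : DdagMon d f S) :
    f ∉ (piO d v S).1 := by
  refine notMem_assoc hvf fun a ha he => ?_
  obtain ⟨j, _, ha⟩ := Finset.mem_biUnion.1 ha
  obtain ⟨i, _, ha⟩ := Finset.mem_biUnion.1 ha
  exact notMem_piMap_fst hvf (h.monOf hf j i).1 (he ▸ row_mem_of_mem_distMon ha)

theorem DdagMon.piO_snd (hf : 1 ≤ f ∧ f ≤ 2 * d) (h : DdagMon d f S) :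
    DdagMon d f (piO d v S).2 :=
  (ddagMon_sum fun j _ => ddagMon_sum fun i _ => (h.monOf hf j i).piMap_snd).mono
    fun _ ha => (Multiset.mem_filter.1 ha).1

end OrthoGrass

theorem proposition4p3 (d : ℕ) (v : Finset ℕ) (hv : v ∈ OrthoGrass.I d)
    (f : ℕ) (hf : 1 ≤ f ∧ f ≤ 2 * d) (hvf : OrthoGrass.DdagSet f v) :
    (∀ w ∈ OrthoGrass.I d, OrthoGrass.Le v w →
      ∀ T : Multiset (ℕ × ℕ), OrthoGrass.IsMonomialIn (OrthoGrass.orthoPos d v) T →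
        OrthoGrass.ODominates d v w T →
        OrthoGrass.DdagSet f w → OrthoGrass.DdagMon d f T →
        OrthoGrass.DdagMon d f (OrthoGrass.phiO d v w T)) ∧
    (∀ S : Multiset (ℕ × ℕ), OrthoGrass.IsMonomialIn (OrthoGrass.orthoPos d v) S →
      OrthoGrass.DdagMon d f S →
      OrthoGrass.DdagSet f (OrthoGrass.piO d v S).1 ∧
        OrthoGrass.DdagMon d f (OrthoGrass.piO d v S).2) :=
  ⟨fun _ hw _ _ _ _ hwf hT => hT.phiO hf hv hvf hw hwf,
    fun _ _ hS => ⟨OrthoGrass.notMem_piO_fst hf hvf hS, hS.piO_snd hf⟩⟩
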